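/- Let $n\ge 0$ and let $\sigma\in S_n$ be an arbitrary permutation of $[n]=\{1,\dots,n\}$. For $d\ge1$ let $\lambda_d$ be the number of cycles of $\sigma$ of length $d$ (fixed points are cycles of length $1$), let $\Lambda_d=\{0\}\cup\{i\in[n]:\sigma^d(i)=i\}$, and let $\Lambda'_d\subseteq\Lambda_d$ consist of $0$ and of the points of $[n]$ whose period under $\sigma$ is a proper divisor of $d$. An \emph{extended $\sigma$-Prüfer sequence} is a sequence of elements of $\{0\}\cup[n]$ of length $\lambda_1+\lambda_2+\dots+\lambda_n$, grouped into successive blocks of lengths $\lambda_1,\dots,\lambda_n$, such that the entries of the $d$-th block belong to $\Lambda_d$ and the last entry of the $d$-th block (if the block is non-empty) belongs to $\Lambda'_d$. A \emph{rooted forest} on $[n]$ is an acyclic graph with vertex set $[n]$ together with a choice of one root in each connected component; it is \emph{$\sigma$-invariant} if $\sigma$ maps edges to edges and roots to roots. The \emph{parent} of a root is $0$; the parent of any other vertex $i$ is the next vertex on the path from $i$ to the root of its component. Then there is a bijection between $\sigma$-invariant rooted forests on $[n]$ and extended $\sigma$-Prüfer sequences. Explicitly, it may be taken to send a forest to its Prüfer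 code, whose $d$-th block is obtained as follows: starting with all $d$-cycles of $\sigma$, repeatedly take, among those remaining $d$-cycles none of whose points is the parent of a point of a remaining $d$-cycle, the one whose minimum is smallest; append the parent of its minimum to the block, and remove this cycle. -/

import Mathlib

/-! The set `[n]` is modelled by `Fin n` with its order, and `{0} ∪ [n]` by `Option (Fin n)`,
where `none` is the adjoined point `0`. -/

namespace SigmaPrufer

/-- The vertex set of the cycle of `σ` through `i`; fixed points are cycles of length one. -/
def cycleSet {n : ℕ} (σ : Equiv.Perm (Fin n)) (i : Fin n) : Finset (Fin n) :=
  Finset.univ.filter (fun j => σ.SameCycle i j)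

/-- The cycles of `σ` of length `d`, each given by its set of points. -/
def cyclesOfLength {n : ℕ} (σ : Equiv.Perm (Fin n)) (d : ℕ) : Finset (Finset (Fin n)) :=
  (Finset.univ.image (cycleSet σ)).filter (fun C => C.card = d)

/-- The number `λ_d` of cycles of `σ` of length `d`. -/
def cycleCount {n : ℕ} (σ : Equiv.Perm (Fin n)) (d : ℕ) : ℕ :=
  (cyclesOfLength σ d).card

/-- The set `Λ_d = {0} ∪ {i ∈ [n] : σ ^ d (i) = i}`. -/
def Lam {n : ℕ} (σ : Equiv.Perm (Fin n)) (d : ℕ) : Set (Option (Fin n)) :=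
  {none} ∪ some '' {i | (σ ^ d) i = i}

/-- The set `Λ'_d`: the point `0`, and the points of `[n]` whose period under `σ` is a proper
divisor of `d`. -/
def LamStrict {n : ℕ} (σ : Equiv.Perm (Fin n)) (d : ℕ) : Set (Option (Fin n)) :=
  {none} ∪ some '' {i | Function.minimalPeriod σ i ∣ d ∧ Function.minimalPeriod σ i ≠ d}

/-- An extended `σ`-Prüfer sequence: a sequence of elements of `{0} ∪ [n]`, grouped in blocks,
one block of length `λ_d` for each cycle length `d` (the blocks with `d = 0` or `n < d` are empty,
since then `λ_d = 0`). The entries of the block of `d`-cycles lie in `Λ_d`, and the last entry of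
that block lies in `Λ'_d`. -/
@[ext]
structure ExtPruferSeq {n : ℕ} (σ : Equiv.Perm (Fin n)) where
  entry : (d : ℕ) → Fin (cycleCount σ d) → Option (Fin n)
  entry_mem : ∀ (d : ℕ) (k : Fin (cycleCount σ d)), entry d k ∈ Lam σ d
  last_mem : ∀ (d : ℕ) (k : Fin (cycleCount σ d)),
    (k : ℕ) + 1 = cycleCount σ d → entry d k ∈ LamStrict σ d

/-- A rooted forest on `[n]`: an acyclic graph with a choice of one root in each of its trees. -/
@[ext]
structure RootedForest (n : ℕ) where
  graph : SimpleGraph (Fin n)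
  roots : Set (Fin n)
  acyclic : graph.IsAcyclic
  existsUnique_root : ∀ v : Fin n, ∃! r : Fin n, r ∈ roots ∧ graph.Reachable v r

namespace RootedForest

/-- `σ` maps the forest to itself: it preserves the edges and the roots. -/
def IsInvariant {n : ℕ} (F : RootedForest n) (σ : Equiv.Perm (Fin n)) : Prop :=
  (∀ i j : Fin n, F.graph.Adj (σ i) (σ j) ↔ F.graph.Adj i j) ∧
    ∀ i : Fin n, σ i ∈ F.roots ↔ i ∈ F.roots

/-- `F.IsParent i a`: the point `a` of `{0} ∪ [n]` is the parent of `i`. The parent of a root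
is `0`; the parent of another vertex `i` is the vertex following `i` on the path from `i` to the
root of its tree. -/
def IsParent {n : ℕ} (F : RootedForest n) (i : Fin n) : Option (Fin n) → Prop
  | none => i ∈ F.roots
  | some j => ∃ r ∈ F.roots, ∃ (h : F.graph.Adj i j) (p : F.graph.Walk j r),
      (SimpleGraph.Walk.cons h p).IsPath

/-- Within a collection `S` of cycles, `C` is a leaf: no vertex of a cycle in `S` has its
parent in `C`. -/
def IsLeafCycle {n : ℕ} (F : RootedForest n) (S : Finset (Finset (Fin n)))
    (C : Finset (Fin n)) : Prop :=
  C ∈ S ∧ ∀ D ∈ S, ∀ i ∈ D, ∀ j ∈ C, ¬ F.IsParent i (some j)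

/-- `C` is the leaf cycle in `S` with the smallest minimum. -/
def IsSmallestLeafCycle {n : ℕ} (F : RootedForest n) (S : Finset (Finset (Fin n)))
    (C : Finset (Fin n)) : Prop :=
  F.IsLeafCycle S C ∧ ∀ D, F.IsLeafCycle S D → C.min ≤ D.min

/-- `s` is the Prüfer code of the forest `F`: for every `d`, remove the `d`-cycles of `σ` one
after the other, always the smallest leaf cycle `c k` among the remaining `d`-cycles; the `k`-th
entry of the block of `d`-cycles is the parent of the minimum of `c k`. -/
def IsCode {n : ℕ} {σ : Equiv.Perm (Fin n)} (F : RootedForest n) (s : ExtPruferSeq σ) : Prop :=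
  ∀ d : ℕ, ∃ c : Fin (cycleCount σ d) → Finset (Fin n), ∀ k : Fin (cycleCount σ d),
    F.IsSmallestLeafCycle ((cyclesOfLength σ d).filter (fun D => ∀ l < k, c l ≠ D)) (c k) ∧
      ∃ m : Fin n, (c k).min = m ∧ F.IsParent m (s.entry d k)

end RootedForest

end SigmaPrufer

/-!
A rooted forest is the same thing as a parent function `p : [n] → {0} ∪ [n]` which decreases some
height (`RootedForest.adj_iff`, `exists_height`, `exists_forest_of_parent`), and it is
`σ`-invariant exactly when `p` commutes with `σ`. So an invariant forest is given by the parents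
of the minima of the cycles of `σ`. The parent of a point of a `d`-cycle lies in `Λ_d`, hence in a
cycle whose length divides `d`, and acyclicity only has to be controlled among the cycles of one
length `d`. There the classical argument of Prüfer applies, with cycles in the place of vertices.

The relation `F.IsCode s` is shown to be the graph of a bijection. Each invariant forest has
exactly one code (`exists_isCode`, `IsCode.unique`): some remaining cycle is always a leaf, since
the height is maximal somewhere, and the last entry is in `Λ'_d`, since every `d`-cycle was a leaf
at the time of its removal (`parent_mem_LamStrict`). Conversely, the order of removal can be read
off from the sequence `s` alone: the parents of the remaining cycles are, up to `σ`, the remaining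
entries, so that a remaining cycle is a leaf exactly when it contains none of these entries
(`isSmallestLeafCycle_iff`). Hence a code determines the forest (`eq_of_isCode`). For an arbitrary
sequence, the same rule yields an enumeration of the `d`-cycles, because the last entry lies in no
`d`-cycle and the remaining entries are therefore too few to meet all remaining cycles
(`exists_avoids`). Taking the entries as parents of the minima gives a parent function which leads
to shorter cycles or to cycles enumerated later, hence a forest with the given code
(`exists_forest_of_code`).
-/

namespace SigmaPrufer

/-! ### Rooted forests and their parent functions -/

namespace RootedForest

variable {n : ℕ} (F : RootedForest n)

lemma root_unique {v r r' : Fin n} (hr : r ∈ F.roots) (hr' : r' ∈ F.roots)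
    (h : F.graph.Reachable v r) (h' : F.graph.Reachable v r') : r = r' :=
  (F.existsUnique_root v).unique ⟨hr, h⟩ ⟨hr', h'⟩

lemma exists_path_to_root (v : Fin n) : ∃ r ∈ F.roots, ∃ w : F.graph.Walk v r, w.IsPath := by
  obtain ⟨r, ⟨hr, hv⟩, -⟩ := F.existsUnique_root v
  obtain ⟨w, hw⟩ := hv.exists_isPath
  exact ⟨r, hr, w, hw⟩

lemma path_unique {u v : Fin n} {p q : F.graph.Walk u v} (hp : p.IsPath) (hq : q.IsPath) :
    p = q :=
  congrArg Subtype.val ((F.acyclic.subsingleton_path u v).elim ⟨p, hp⟩ ⟨q, hq⟩)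

lemma exists_isParent (i : Fin n) : ∃ a, F.IsParent i a := by
  obtain ⟨r, hr, w, hw⟩ := F.exists_path_to_root i
  cases w with
  | nil => exact ⟨none, hr⟩
  | cons h p => exact ⟨some _, r, hr, h, p, hw⟩

lemma not_mem_roots_of_isParent_some {i j : Fin n} (h : F.IsParent i (some j)) :
    i ∉ F.roots := by
  intro hi
  obtain ⟨r, hr, h, p, hp⟩ := h
  obtain rfl := F.root_unique hi hr (.refl i) ⟨.cons h p⟩
  exact SimpleGraph.Walk.not_nil_cons (h := h) (p := p)
    (by rw [F.path_unique hp SimpleGraph.Walk.IsPath.nil]; exact SimpleGraph.Walk.Nil.nil)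

lemma isParent_unique {i : Fin n} {a b : Option (Fin n)} (ha : F.IsParent i a)
    (hb : F.IsParent i b) : a = b := by
  match a, b, ha, hb with
  | none, none, _, _ => rfl
  | none, some j, ha, hb => exact absurd ha (F.not_mem_roots_of_isParent_some hb)
  | some j, none, ha, hb => exact absurd hb (F.not_mem_roots_of_isParent_some ha)
  | some j, some k, ⟨r, hr, h, p, hp⟩, ⟨r', hr', h', p', hp'⟩ =>
    obtain rfl := F.root_unique hr hr' ⟨.cons h p⟩ ⟨.cons h' p'⟩
    have := congrArg SimpleGraph.Walk.snd (F.path_unique hp hp')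
    simpa using this

/-- The parent function of a rooted forest, with the value `none` (the point `0`) at the roots. -/
noncomputable def parent (i : Fin n) : Option (Fin n) := (F.exists_isParent i).choose

lemma isParent_iff {i : Fin n} {a : Option (Fin n)} : F.IsParent i a ↔ F.parent i = a :=
  ⟨F.isParent_unique (F.exists_isParent i).choose_spec,
    fun h => h ▸ (F.exists_isParent i).choose_spec⟩

lemma mem_roots_iff {i : Fin n} : i ∈ F.roots ↔ F.parent i = none :=
  F.isParent_iff (a := none)

/-- Each edge joins a vertex to its parent: an edge `ij` is either the first step of the path
from `i` to the root, or it can be put in front of that path. -/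
lemma adj_iff {i j : Fin n} :
    F.graph.Adj i j ↔ F.parent i = some j ∨ F.parent j = some i := by
  simp only [← isParent_iff]
  constructor
  · intro h
    obtain ⟨r, hr, w, hw⟩ := F.exists_path_to_root i
    by_cases hj : j ∈ w.support
    · left
      obtain rfl := F.acyclic.eq_snd_of_adj_start hw h hj
      cases w with
      | nil => simp at h
      | cons h' p =>
        simp only [SimpleGraph.Walk.snd_cons]
        exact ⟨r, hr, h', p, hw⟩
    · exact .inr ⟨r, hr, h.symm, w, hw.cons hj⟩
  · rintro (⟨-, -, h, -⟩ | ⟨-, -, h, -⟩)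
    exacts [h, h.symm]

lemma eq_of_parent_eq {F G : RootedForest n} (h : F.parent = G.parent) : F = G := by
  ext i j
  · rw [adj_iff, adj_iff, h]
  · rw [mem_roots_iff, mem_roots_iff, h]

lemma IsInvariant.parent_apply {F : RootedForest n} {σ : Equiv.Perm (Fin n)}
    (hF : F.IsInvariant σ) (i : Fin n) : F.parent (σ i) = (F.parent i).map σ := by
  cases h : F.parent i with
  | none => exact F.mem_roots_iff.1 ((hF.2 i).2 (F.mem_roots_iff.2 h))
  | some j =>
    obtain ⟨r, hr, h, p, hp⟩ := F.isParent_iff.2 h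
    let f : F.graph →g F.graph := ⟨σ, fun {a b} => (hF.1 a b).2⟩
    refine F.isParent_iff.1 ⟨σ r, (hF.2 r).2 hr, (hF.1 i j).2 h, p.map f, ?_⟩
    exact hp.map (f := f) σ.injective

lemma IsInvariant.parent_zpow_apply {F : RootedForest n} {σ : Equiv.Perm (Fin n)}
    (hF : F.IsInvariant σ) (t : ℤ) (i : Fin n) :
    F.parent ((σ ^ t) i) = (F.parent i).map (σ ^ t) := by
  induction t with
  | zero => simp
  | succ t ih =>
    rw [add_comm, zpow_one_add, Equiv.Perm.mul_apply, hF.parent_apply, ih, Option.map_map,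
      Equiv.Perm.coe_mul]
  | pred t ih =>
    apply Option.map_injective σ.injective
    rw [← hF.parent_apply, Option.map_map, ← Equiv.Perm.coe_mul, ← Equiv.Perm.mul_apply,
      ← zpow_one_add, add_sub_cancel, ih]

/-- The height of a vertex is the length of its path to the root. -/
lemma exists_height : ∃ h : Fin n → ℕ, ∀ i j, F.parent i = some j → h j < h i := by
  choose r hr w hw using F.exists_path_to_root
  refine ⟨fun v => (w v).length, fun i j hij => ?_⟩
  obtain ⟨s, hs, h, p, hp⟩ := F.isParent_iff.2 hij
  have key : ∀ v s' (q : F.graph.Walk v s'), s' ∈ F.roots → q.IsPath →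
      (w v).length = q.length := by
    intro v s' q hs' hq
    obtain rfl := F.root_unique hs' (hr v) ⟨q⟩ ⟨w v⟩
    rw [F.path_unique hq (hw v)]
  have h1 := key i s _ hs hp
  have h2 := key j s _ hs hp.of_cons
  simp only [SimpleGraph.Walk.length_cons] at h1
  show (w j).length < (w i).length
  omega

end RootedForest

/-- The graph joining each point to its image under a partial function `p`. -/
def parentGraph {n : ℕ} (p : Fin n → Option (Fin n)) : SimpleGraph (Fin n) :=
  .fromRel fun i j => p i = some j

lemma parentGraph_adj {n : ℕ} {p : Fin n → Option (Fin n)} {h : Fin n → ℕ}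
    (hp : ∀ i j, p i = some j → h j < h i) {i j : Fin n} :
    (parentGraph p).Adj i j ↔ p i = some j ∨ p j = some i := by
  simp only [parentGraph, SimpleGraph.fromRel_adj, ne_eq, and_iff_right_iff_imp]
  rintro (hij | hij) rfl <;> exact lt_irrefl _ (hp _ _ hij)

/-- On a cycle, a vertex of maximal height would have two distinct neighbours which both are
its image under `p`. -/
lemma parentGraph_isAcyclic {n : ℕ} {p : Fin n → Option (Fin n)} {h : Fin n → ℕ}
    (hp : ∀ i j, p i = some j → h j < h i) : (parentGraph p).IsAcyclic := by
  intro v c hc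
  obtain ⟨u, hu, hmax⟩ := c.support.toFinset.exists_max_image h ⟨v, by simp⟩
  simp only [List.mem_toFinset] at hu hmax
  have key : ∀ x ∈ c.support, (parentGraph p).Adj u x → p u = some x := by
    intro x hx hux
    refine ((parentGraph_adj hp).1 hux).resolve_right fun hxu => ?_
    exact (hp _ _ hxu).not_ge (hmax x hx)
  have hc' := hc.rotate hu
  have hsupp : ∀ x ∈ (c.rotate u hu).support, x ∈ c.support := by
    intro x hx
    exact (SimpleGraph.Walk.mem_support_rotate_iff _ _ hu).1 hx
  have h1 := key _ (hsupp _ (SimpleGraph.Walk.getVert_mem_support _ _))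
    (SimpleGraph.Walk.adj_snd hc'.not_nil)
  have h2 := key _ (hsupp _ (SimpleGraph.Walk.getVert_mem_support _ _))
    (SimpleGraph.Walk.adj_penultimate hc'.not_nil).symm
  exact hc'.snd_ne_penultimate (Option.some.inj (h1.symm.trans h2))

/-- Following `p` from `v` gives a path of decreasing heights. -/
lemma exists_parentGraph_path {n : ℕ} {p : Fin n → Option (Fin n)} {h : Fin n → ℕ}
    (hp : ∀ i j, p i = some j → h j < h i) (v : Fin n) :
    ∃ r, p r = none ∧ ∃ w : (parentGraph p).Walk v r, w.IsPath ∧ ∀ u ∈ w.support, h u ≤ h v := by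
  induction hv : h v using Nat.strong_induction_on generalizing v with
  | _ m ih =>
    subst hv
    cases hpv : p v with
    | none => exact ⟨v, hpv, .nil, .nil, by simp⟩
    | some j =>
      have hlt := hp _ _ hpv
      obtain ⟨r, hr, w, hw, hle⟩ := ih _ hlt j rfl
      refine ⟨r, hr, .cons ((parentGraph_adj hp).2 (.inl hpv)) w, hw.cons fun hmem => ?_, ?_⟩
      · exact hlt.not_ge (hle _ hmem)
      · simp only [SimpleGraph.Walk.support_cons, List.mem_cons, forall_eq_or_imp, le_refl,
          true_and]
        exact fun u hu => (hle u hu).trans hlt.le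

/-- If `w` is in the component of a point `r` without image, then `p` leads from `w` to `r`. -/
lemma reflTransGen_of_reachable {n : ℕ} {p : Fin n → Option (Fin n)} {h : Fin n → ℕ}
    (hp : ∀ i j, p i = some j → h j < h i) {v r : Fin n} (hr : p r = none)
    (hv : (parentGraph p).Reachable v r) :
    Relation.ReflTransGen (fun i j => p i = some j) v r := by
  obtain ⟨w⟩ := hv
  induction w with
  | nil => exact .refl
  | cons hadj _ ih =>
    have ih := ih hr
    rcases (parentGraph_adj hp).1 hadj with h1 | h1
    · exact .head h1 ih
    · rcases ih.cases_head with h2 | ⟨c, hc, hcr⟩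
      · rw [h2, hr] at h1
        cases h1
      · rw [h1] at hc
        exact Option.some.inj hc ▸ hcr

/-- A partial function which decreases some height is the parent function of a rooted forest. -/
lemma exists_forest_of_parent {n : ℕ} {p : Fin n → Option (Fin n)} {h : Fin n → ℕ}
    (hp : ∀ i j, p i = some j → h j < h i) : ∃ F : RootedForest n, F.parent = p := by
  refine ⟨⟨parentGraph p, {i | p i = none}, parentGraph_isAcyclic hp, fun v => ?_⟩, ?_⟩
  · obtain ⟨r, hr, w, -⟩ := exists_parentGraph_path hp v
    refine ⟨r, ⟨hr, ⟨w⟩⟩, fun r' ⟨hr', hv'⟩ => ?_⟩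
    have := reflTransGen_of_reachable hp hr (hv'.symm.trans ⟨w⟩)
    rcases this.cases_head with h2 | ⟨c, hc, -⟩
    · exact h2
    · rw [show p r' = none from hr'] at hc
      cases hc
  · funext i
    rw [← RootedForest.isParent_iff]
    cases hpi : p i with
    | none => exact hpi
    | some j =>
      obtain ⟨r, hr, w, hw, hle⟩ := exists_parentGraph_path hp j
      exact ⟨r, hr, (parentGraph_adj hp).2 (.inl hpi), w,
        hw.cons fun hmem => (hp _ _ hpi).not_ge (hle _ hmem)⟩

lemma RootedForest.isInvariant_of_parent {n : ℕ} {F : RootedForest n} {σ : Equiv.Perm (Fin n)}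
    (hF : ∀ i, F.parent (σ i) = (F.parent i).map σ) : F.IsInvariant σ := by
  refine ⟨fun i j => ?_, fun i => ?_⟩
  · simp [F.adj_iff, hF]
  · simp [F.mem_roots_iff, hF]

/-! ### Cycles of a permutation -/

section Cycles

variable {n : ℕ} {σ : Equiv.Perm (Fin n)}

lemma mem_cycleSet {i j : Fin n} : j ∈ cycleSet σ i ↔ σ.SameCycle i j := by
  simp [cycleSet]

lemma self_mem_cycleSet (i : Fin n) : i ∈ cycleSet σ i := mem_cycleSet.2 (.refl σ i)

lemma cycleSet_eq_of_mem {i j : Fin n} (h : j ∈ cycleSet σ i) : cycleSet σ j = cycleSet σ i := by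
  ext k
  rw [mem_cycleSet] at h
  rw [mem_cycleSet, mem_cycleSet]
  exact ⟨h.trans, h.symm.trans⟩

lemma card_cycleSet (i : Fin n) : (cycleSet σ i).card = Function.minimalPeriod σ i := by
  classical
  have h := MulAction.minimalPeriod_eq_card σ i
  rw [← Set.toFinset_card] at h
  change Function.minimalPeriod σ i = _ at h
  rw [h]
  congr 1
  ext j
  rw [mem_cycleSet, Set.mem_toFinset, MulAction.mem_orbit_iff]
  constructor
  · rintro ⟨t, ht⟩
    exact ⟨⟨σ ^ t, t, rfl⟩, ht⟩
  · rintro ⟨⟨_, t, rfl⟩, ht⟩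
    exact ⟨t, ht⟩

lemma mem_cyclesOfLength {d : ℕ} {C : Finset (Fin n)} :
    C ∈ cyclesOfLength σ d ↔ ∃ i, cycleSet σ i = C ∧ Function.minimalPeriod σ i = d := by
  simp only [cyclesOfLength, Finset.mem_filter, Finset.mem_image, Finset.mem_univ, true_and]
  constructor
  · rintro ⟨⟨i, rfl⟩, h⟩
    exact ⟨i, rfl, card_cycleSet (σ := σ) i ▸ h⟩
  · rintro ⟨i, rfl, h⟩
    exact ⟨⟨i, rfl⟩, card_cycleSet (σ := σ) i ▸ h⟩

lemma cycleSet_mem_cyclesOfLength (i : Fin n) :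
    cycleSet σ i ∈ cyclesOfLength σ (Function.minimalPeriod σ i) :=
  mem_cyclesOfLength.2 ⟨i, rfl, rfl⟩

section

variable {d : ℕ} {C D : Finset (Fin n)} {i j : Fin n}

lemma eq_cycleSet_of_mem (hC : C ∈ cyclesOfLength σ d) (hi : i ∈ C) : C = cycleSet σ i := by
  obtain ⟨j, rfl, -⟩ := mem_cyclesOfLength.1 hC
  exact (cycleSet_eq_of_mem hi).symm

lemma minimalPeriod_eq_of_mem (hC : C ∈ cyclesOfLength σ d) (hi : i ∈ C) :
    Function.minimalPeriod σ i = d := by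
  rw [← card_cycleSet, ← eq_cycleSet_of_mem hC hi]
  exact (Finset.mem_filter.1 hC).2

lemma eq_of_mem_of_mem (hC : C ∈ cyclesOfLength σ d) (hD : D ∈ cyclesOfLength σ d)
    (hi : i ∈ C) (hi' : i ∈ D) : C = D :=
  (eq_cycleSet_of_mem hC hi).trans (eq_cycleSet_of_mem hD hi').symm

lemma exists_min_eq (hC : C ∈ cyclesOfLength σ d) : ∃ m : Fin n, C.min = m := by
  obtain ⟨i, rfl, -⟩ := mem_cyclesOfLength.1 hC
  exact Finset.min_of_mem (self_mem_cycleSet i)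

lemma eq_of_min_eq (hC : C ∈ cyclesOfLength σ d) (hD : D ∈ cyclesOfLength σ d)
    (h : C.min = D.min) : C = D := by
  obtain ⟨m, hm⟩ := exists_min_eq hC
  exact eq_of_mem_of_mem hC hD (Finset.mem_of_min hm) (Finset.mem_of_min (h ▸ hm))

lemma zpow_apply_mem_iff (hC : C ∈ cyclesOfLength σ d) (t : ℤ) : (σ ^ t) i ∈ C ↔ i ∈ C := by
  obtain ⟨j, rfl, -⟩ := mem_cyclesOfLength.1 hC
  rw [mem_cycleSet, mem_cycleSet, Equiv.Perm.sameCycle_zpow_right]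

lemma exists_zpow_apply_eq (hC : C ∈ cyclesOfLength σ d) (hi : i ∈ C) (hj : j ∈ C) :
    ∃ t : ℤ, (σ ^ t) i = j := by
  rw [eq_cycleSet_of_mem hC hi, mem_cycleSet] at hj
  exact hj

lemma pow_apply_eq_self_iff : (σ ^ d) i = i ↔ Function.minimalPeriod σ i ∣ d := by
  rw [← Function.isPeriodicPt_iff_minimalPeriod_dvd, Function.IsPeriodicPt, Function.IsFixedPt,
    Equiv.Perm.iterate_eq_pow]

lemma mem_Lam_iff {a : Option (Fin n)} : a ∈ Lam σ d ↔ a.map (σ ^ d) = a := by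
  cases a <;> simp [Lam]

/-- Powers of `σ` which agree at a point of a `d`-cycle agree on `Λ_d`. -/
lemma map_zpow_eq_of_zpow_apply_eq {a : Option (Fin n)} (ha : a ∈ Lam σ d)
    (hi : Function.minimalPeriod σ i = d) {s t : ℤ} (h : (σ ^ s) i = (σ ^ t) i) :
    a.map (σ ^ s) = a.map (σ ^ t) := by
  cases a with
  | none => rfl
  | some j =>
    simp only [mem_Lam_iff, Option.map_some, Option.some.injEq] at ha ⊢
    have hdvd : (d : ℤ) ∣ s - t := by
      rw [← hi]
      refine (MulAction.zpow_smul_eq_iff_minimalPeriod_dvd (a := σ) (b := i)).1 ?_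
      rw [Equiv.Perm.smul_def, sub_eq_neg_add, zpow_add, Equiv.Perm.mul_apply, h,
        ← Equiv.Perm.mul_apply, ← zpow_add, neg_add_cancel, zpow_zero, Equiv.Perm.one_apply]
    obtain ⟨q, hq⟩ := hdvd
    rw [sub_eq_iff_eq_add'.1 hq, zpow_add, Equiv.Perm.mul_apply, zpow_mul, zpow_natCast,
      Equiv.Perm.zpow_apply_eq_self_of_apply_eq_self ha]

end

lemma cycleCount_le (d : ℕ) : cycleCount σ d ≤ n :=
  calc cycleCount σ d ≤ (Finset.univ.image (cycleSet σ)).card := Finset.card_filter_le _ _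
    _ ≤ n := Finset.card_image_le.trans (by simp)

end Cycles

/-! ### Greedy enumerations -/

section Greedy

variable {ι : Type*} [DecidableEq ι] {T : Finset ι}

/-- The members of `T` which are left when `c l` has been removed for all `l < k`. -/
def remaining {N : ℕ} (T : Finset ι) (c : Fin N → ι) (k : Fin N) : Finset ι :=
  T.filter fun D => ∀ l < k, c l ≠ D

variable {N : ℕ} {c : Fin N → ι} {k : Fin N} {D : ι}

lemma mem_remaining : D ∈ remaining T c k ↔ D ∈ T ∧ ∀ l < k, c l ≠ D := by
  simp [remaining]

lemma remaining_congr {c' : Fin N → ι} (h : ∀ l < k, c l = c' l) :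
    remaining T c k = remaining T c' k := by
  ext D
  simp only [mem_remaining]
  exact and_congr_right fun _ => forall₂_congr fun l hl => by rw [h l hl]

lemma injective_of_mem_remaining (hc : ∀ k, c k ∈ remaining T c k) : Function.Injective c := by
  intro k l hkl
  rcases lt_trichotomy k l with h | h | h
  · exact absurd hkl ((mem_remaining.1 (hc l)).2 k h)
  · exact h
  · exact absurd hkl.symm ((mem_remaining.1 (hc k)).2 l h)

/-- An enumeration of `T` without repetition, with as many terms as `T` has members, reaches
every member. -/
lemma exists_eq_of_mem_remaining (hT : T.card = N) (hc : ∀ k, c k ∈ remaining T c k)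
    (hD : D ∈ T) : ∃ k, c k = D := by
  have himage : Finset.univ.image c = T := by
    refine Finset.eq_of_subset_of_card_le (fun D hD => ?_) ?_
    · obtain ⟨k, -, rfl⟩ := Finset.mem_image.1 hD
      exact (mem_remaining.1 (hc k)).1
    · rw [Finset.card_image_of_injective _ (injective_of_mem_remaining hc), hT]
      simp
  rw [← himage] at hD
  obtain ⟨k, -, hk⟩ := Finset.mem_image.1 hD
  exact ⟨k, hk⟩

lemma mem_remaining_iff_exists (hT : T.card = N) (hc : ∀ k, c k ∈ remaining T c k) :
    D ∈ remaining T c k ↔ ∃ l, k ≤ l ∧ c l = D := by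
  constructor
  · intro hD
    obtain ⟨l, rfl⟩ := exists_eq_of_mem_remaining hT hc (mem_remaining.1 hD).1
    exact ⟨l, not_lt.1 fun hl => (mem_remaining.1 hD).2 l hl rfl, rfl⟩
  · rintro ⟨l, hkl, rfl⟩
    exact mem_remaining.2 ⟨(mem_remaining.1 (hc l)).1, fun l' hl' =>
      (mem_remaining.1 (hc l)).2 l' (hl'.trans_le hkl)⟩

/-- Members of `T` can be removed one after the other, each by a rule `P k S` which allows some
choice from any set `S` that may be left at the `k`-th step. -/
lemma exists_greedy (hT : T.card = N) (P : Fin N → Finset ι → ι → Prop)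
    (hP : ∀ k : Fin N, ∀ S ⊆ T, S.card = N - k → ∃ C ∈ S, P k S C) :
    ∃ c : Fin N → ι, ∀ k, c k ∈ remaining T c k ∧ P k (remaining T c k) (c k) := by
  classical
  rcases Nat.eq_zero_or_pos N with rfl | hN
  · exact ⟨fun k => k.elim0, fun k => k.elim0⟩
  have hne : Nonempty ι := by
    obtain ⟨D, -⟩ := Finset.card_pos.1 (hT ▸ hN)
    exact ⟨D⟩
  choose! f hf hPf using hP
  -- `S k` is the set left at the `k`-th step
  let S : ℕ → Finset ι := fun k => Nat.rec T
    (fun k S => if h : k < N then S.erase (f ⟨k, h⟩ S) else S) k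
  have hS : ∀ k (h : k < N), S (k + 1) = (S k).erase (f ⟨k, h⟩ (S k)) := fun k h => dif_pos h
  let c : Fin N → ι := fun k => f k (S k)
  have hST : ∀ k ≤ N, S k ⊆ T ∧ (S k).card = N - k := by
    intro k
    induction k with
    | zero => exact fun _ => ⟨subset_rfl, hT⟩
    | succ k ih =>
      intro hk
      obtain ⟨h1, h2⟩ := ih (by omega)
      rw [hS k hk]
      refine ⟨(Finset.erase_subset _ _).trans h1, ?_⟩
      rw [Finset.card_erase_of_mem (hf ⟨k, hk⟩ _ h1 h2), h2]
      omega
  have hSc : ∀ k (h : k ≤ N), ∀ D, D ∈ S k ↔ D ∈ T ∧ ∀ l : Fin N, (l : ℕ) < k → c l ≠ D := by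
    intro k
    induction k with
    | zero => intro _ D; simp [S]
    | succ k ih =>
      intro hk D
      rw [hS k hk, Finset.mem_erase, ih (by omega)]
      constructor
      · rintro ⟨h1, h2, h3⟩
        refine ⟨h2, fun l hl => ?_⟩
        rcases Nat.lt_succ_iff_lt_or_eq.1 hl with hl | hl
        · exact h3 l hl
        · obtain rfl : l = ⟨k, hk⟩ := Fin.ext hl
          exact h1.symm
      · rintro ⟨h2, h3⟩
        exact ⟨(h3 ⟨k, hk⟩ (Nat.lt_succ_self k)).symm, h2, fun l hl => h3 l (by omega)⟩
  refine ⟨c, fun k => ?_⟩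
  have hrem : remaining T c k = S k := by
    ext D
    rw [mem_remaining, hSc k k.2.le]
    rfl
  obtain ⟨h1, h2⟩ := hST k k.2.le
  rw [hrem]
  exact ⟨hf k _ h1 h2, hPf k _ h1 h2⟩

/-- A removal process whose steps are determined by what is left is unique. -/
lemma greedy_unique (P : Fin N → Finset ι → ι → Prop)
    (hP : ∀ k, ∀ S ⊆ T, ∀ C D, P k S C → P k S D → C = D) {c c' : Fin N → ι}
    (hc : ∀ k, P k (remaining T c k) (c k)) (hc' : ∀ k, P k (remaining T c' k) (c' k)) :
    c = c' := by
  funext k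
  induction k using WellFoundedLT.induction with
  | _ k ih =>
    have h := hc' k
    rw [← remaining_congr ih] at h
    exact hP k _ (Finset.filter_subset _ _) _ _ (hc k) h

end Greedy

/-! ### The order of removal read off from a sequence -/

section Sequence

variable {n : ℕ} {σ : Equiv.Perm (Fin n)}

namespace ExtPruferSeq

variable (s : ExtPruferSeq σ) (d : ℕ)

/-- No entry of the block of `d`-cycles, from the `k`-th on, lies in `C`. -/
def Avoids (k : Fin (cycleCount σ d)) (C : Finset (Fin n)) : Prop :=
  ∀ l, k ≤ l → ∀ j ∈ C, s.entry d l ≠ some j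

/-- `C` has the smallest minimum among the members of `S` avoided by the block of `d`-cycles
from the `k`-th entry on. -/
def IsSmallestAvoided (k : Fin (cycleCount σ d)) (S : Finset (Finset (Fin n)))
    (C : Finset (Fin n)) : Prop :=
  (C ∈ S ∧ s.Avoids d k C) ∧ ∀ D ∈ S, s.Avoids d k D → C.min ≤ D.min

variable {s d}

/-- The last entry of the block lies in no `d`-cycle, and each other entry from the `k`-th on
lies in at most one, so that they miss one of any `λ_d - k` cycles. -/
lemma exists_avoids {k : Fin (cycleCount σ d)} {S : Finset (Finset (Fin n))}
    (hS : S ⊆ cyclesOfLength σ d) (hcard : S.card = cycleCount σ d - k) :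
    ∃ C ∈ S, s.Avoids d k C := by
  by_contra! hall
  have hk := k.2
  have hall' : ∀ C ∈ S, ∃ l, k ≤ l ∧ ∃ j ∈ C, s.entry d l = some j := by
    intro C hC
    have := hall C hC
    simp only [Avoids] at this
    push Not at this
    exact this
  have : Nonempty (Fin (cycleCount σ d)) := ⟨k⟩
  choose! f hkf hf using hall'
  have hlt : cycleCount σ d - 1 < cycleCount σ d := by omega
  have hle : S.card ≤ (Finset.Ico k ⟨cycleCount σ d - 1, hlt⟩).card := by
    refine Finset.card_le_card_of_injOn f (fun C hC => ?_) (fun C hC D hD hCD => ?_)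
    · refine Finset.mem_coe.2 (Finset.mem_Ico.2 ⟨hkf C hC, Fin.lt_def.2 ?_⟩)
      by_contra hlast
      have hlast' : (f C : ℕ) + 1 = cycleCount σ d := by
        have := (f C).2
        simp only at hlast
        omega
      obtain ⟨j, hj, hjs⟩ := hf C hC
      have := s.last_mem d (f C) hlast'
      rw [hjs] at this
      simp only [LamStrict, Set.singleton_union, Set.mem_insert_iff, reduceCtorEq, Set.mem_image,
        Set.mem_ofPred_eq, Option.some.injEq, exists_eq_right, false_or] at this
      exact this.2 (minimalPeriod_eq_of_mem (hS hC) hj)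
    · obtain ⟨i, hi, his⟩ := hf C hC
      obtain ⟨j, hj, hjs⟩ := hf D hD
      obtain rfl : i = j := Option.some.inj <| by rw [← his, ← hjs, hCD]
      exact eq_of_mem_of_mem (hS hC) (hS hD) hi hj
  rw [Fin.card_Ico, hcard] at hle
  simp only at hle
  omega

lemma exists_isSmallestAvoided {k : Fin (cycleCount σ d)} {S : Finset (Finset (Fin n))}
    (hS : S ⊆ cyclesOfLength σ d) (hcard : S.card = cycleCount σ d - k) :
    ∃ C ∈ S, s.IsSmallestAvoided d k S C := by
  classical
  obtain ⟨C₀, hC₀, hC₀'⟩ := exists_avoids (s := s) hS hcard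
  obtain ⟨C, hC, hmin⟩ := (S.filter (s.Avoids d k)).exists_min_image Finset.min
    ⟨C₀, Finset.mem_filter.2 ⟨hC₀, hC₀'⟩⟩
  have hC' := Finset.mem_filter.1 hC
  exact ⟨C, hC'.1, hC', fun D hD hD' => hmin D (Finset.mem_filter.2 ⟨hD, hD'⟩)⟩

lemma IsSmallestAvoided.unique {k : Fin (cycleCount σ d)} {S : Finset (Finset (Fin n))}
    (hS : S ⊆ cyclesOfLength σ d) {C D : Finset (Fin n)} (hC : s.IsSmallestAvoided d k S C)
    (hD : s.IsSmallestAvoided d k S D) : C = D :=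
  eq_of_min_eq (hS hC.1.1) (hS hD.1.1)
    (le_antisymm (hC.2 D hD.1.1 hD.1.2) (hD.2 C hC.1.1 hC.1.2))

end ExtPruferSeq

/-! ### The code of a forest -/

namespace RootedForest

variable {F : RootedForest n} {d : ℕ}

lemma IsSmallestLeafCycle.mem {S : Finset (Finset (Fin n))} {C : Finset (Fin n)}
    (h : F.IsSmallestLeafCycle S C) : C ∈ S := h.1.1

lemma IsSmallestLeafCycle.unique {S : Finset (Finset (Fin n))} (hS : S ⊆ cyclesOfLength σ d)
    {C D : Finset (Fin n)} (hC : F.IsSmallestLeafCycle S C) (hD : F.IsSmallestLeafCycle S D) :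
    C = D :=
  eq_of_min_eq (hS hC.mem) (hS hD.mem) (le_antisymm (hC.2 D hD.1) (hD.2 C hC.1))

/-- The cycle through a vertex of maximal height is a leaf. -/
lemma exists_isSmallestLeafCycle {S : Finset (Finset (Fin n))} (hF : F.IsInvariant σ)
    (hS : S ⊆ cyclesOfLength σ d) (hne : S.Nonempty) : ∃ C, F.IsSmallestLeafCycle S C := by
  classical
  obtain ⟨h, hh⟩ := F.exists_height
  have hleaf : ∃ C, F.IsLeafCycle S C := by
    obtain ⟨C₀, hC₀⟩ := hne
    obtain ⟨m₀, hm₀⟩ := exists_min_eq (hS hC₀)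
    obtain ⟨i, hi, hmax⟩ := (S.biUnion id).exists_max_image h
      ⟨m₀, Finset.mem_biUnion.2 ⟨C₀, hC₀, Finset.mem_of_min hm₀⟩⟩
    obtain ⟨C, hC, hiC⟩ := Finset.mem_biUnion.1 hi
    refine ⟨C, hC, fun D hD x hx j hj hxj => ?_⟩
    -- some power of `σ` moves the parent `j` of `x` to `i`, and then `x` to a vertex above `i`
    obtain ⟨t, ht⟩ := exists_zpow_apply_eq (hS hC) hj hiC
    have hpar : F.parent ((σ ^ t) x) = some i := by
      rw [hF.parent_zpow_apply, F.isParent_iff.1 hxj, Option.map_some, ht]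
    exact (hh _ _ hpar).not_ge (hmax _ (Finset.mem_biUnion.2
      ⟨D, hD, (zpow_apply_mem_iff (hS hD) t).2 hx⟩))
  obtain ⟨C₀, hC₀⟩ := hleaf
  obtain ⟨C, hC, hmin⟩ := (S.filter (F.IsLeafCycle S)).exists_min_image Finset.min
    ⟨C₀, Finset.mem_filter.2 ⟨hC₀.1, hC₀⟩⟩
  exact ⟨C, (Finset.mem_filter.1 hC).2, fun D hD => hmin D (Finset.mem_filter.2 ⟨hD.1, hD⟩)⟩

lemma parent_mem_Lam (hF : F.IsInvariant σ) {m : Fin n} (hm : Function.minimalPeriod σ m = d) :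
    F.parent m ∈ Lam σ d := by
  have h := hF.parent_zpow_apply d m
  rw [zpow_natCast, pow_apply_eq_self_iff.2 hm.dvd] at h
  exact mem_Lam_iff.2 h.symm

/-- The parent of the cycle removed last is not in a `d`-cycle, as each `d`-cycle was a leaf when
it was removed, and the last cycle was still there at that time. -/
lemma parent_mem_LamStrict (hF : F.IsInvariant σ)
    {c : Fin (cycleCount σ d) → Finset (Fin n)}
    (hc : ∀ k, F.IsSmallestLeafCycle (remaining (cyclesOfLength σ d) c k) (c k))
    {k : Fin (cycleCount σ d)} (hk : (k : ℕ) + 1 = cycleCount σ d) {m : Fin n} (hm : m ∈ c k) :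
    F.parent m ∈ LamStrict σ d := by
  have hck := (mem_remaining.1 (hc k).mem).1
  have hLam := parent_mem_Lam hF (minimalPeriod_eq_of_mem hck hm)
  cases hj : F.parent m with
  | none => exact .inl rfl
  | some j =>
    rw [hj, mem_Lam_iff, Option.map_some, Option.some.injEq, pow_apply_eq_self_iff] at hLam
    refine .inr ⟨j, ⟨hLam, fun hjd => ?_⟩, rfl⟩
    obtain ⟨l, hl⟩ := exists_eq_of_mem_remaining rfl (fun k => (hc k).mem)
      (hjd ▸ cycleSet_mem_cyclesOfLength j)
    have hl' : (l : ℕ) < cycleCount σ d := l.2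
    have hlk : l ≤ k := Fin.le_def.2 (by omega)
    exact (hc l).1.2 (c k) ((mem_remaining_iff_exists rfl fun k => (hc k).mem).2 ⟨k, hlk, rfl⟩)
      m hm j (hl ▸ self_mem_cycleSet j) (F.isParent_iff.2 hj)

lemma exists_isCode (hF : F.IsInvariant σ) : ∃ s : ExtPruferSeq σ, F.IsCode s := by
  have hgreedy : ∀ d, ∃ c : Fin (cycleCount σ d) → Finset (Fin n), ∀ k,
      c k ∈ remaining (cyclesOfLength σ d) c k ∧
        F.IsSmallestLeafCycle (remaining (cyclesOfLength σ d) c k) (c k) := by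
    intro d
    refine exists_greedy rfl (fun _ S C => F.IsSmallestLeafCycle S C) fun k S hS hcard => ?_
    have hpos : 0 < S.card := by
      have := k.2
      omega
    obtain ⟨C, hC⟩ := exists_isSmallestLeafCycle hF hS (Finset.card_pos.1 hpos)
    exact ⟨C, hC.mem, hC⟩
  choose c hrem hc using hgreedy
  have hmem : ∀ d k, c d k ∈ cyclesOfLength σ d := fun d k => (mem_remaining.1 (hrem d k)).1
  choose m hm using fun d k => exists_min_eq (hmem d k)
  refine ⟨⟨fun d k => F.parent (m d k), fun d k => ?_, fun d k hk => ?_⟩, fun d =>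
    ⟨c d, fun k => ⟨hc d k, m d k, hm d k, F.isParent_iff.2 rfl⟩⟩⟩
  · exact parent_mem_Lam hF (minimalPeriod_eq_of_mem (hmem d k) (Finset.mem_of_min (hm d k)))
  · exact parent_mem_LamStrict hF (hc d) hk (Finset.mem_of_min (hm d k))

lemma IsCode.unique {s s' : ExtPruferSeq σ} (h : F.IsCode s) (h' : F.IsCode s') : s = s' := by
  ext1
  funext d k
  obtain ⟨c, hc⟩ := h d
  obtain ⟨c', hc'⟩ := h' d
  obtain rfl : c = c' := greedy_unique (T := cyclesOfLength σ d)
    (fun _ S C => F.IsSmallestLeafCycle S C) (fun _ _ hS _ _ hC hD => hC.unique hS hD)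
    (fun k => (hc k).1) (fun k => (hc' k).1)
  obtain ⟨-, m, hm, hpar⟩ := hc k
  obtain ⟨-, m', hm', hpar'⟩ := hc' k
  obtain rfl : m = m' := WithTop.coe_injective (hm.symm.trans hm')
  exact F.isParent_unique hpar hpar'

/-- The forest can be replaced by its code in the description of the leaf cycles: the parents of
the points of `c l` form the orbit of the `l`-th entry, so that one of them lies in a given cycle
exactly when the `l`-th entry does. -/
lemma isSmallestLeafCycle_iff (hF : F.IsInvariant σ) {s : ExtPruferSeq σ}
    {c : Fin (cycleCount σ d) → Finset (Fin n)}
    (hc : ∀ k, c k ∈ remaining (cyclesOfLength σ d) c k)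
    (hpar : ∀ k, ∃ m : Fin n, (c k).min = m ∧ F.IsParent m (s.entry d k))
    {k : Fin (cycleCount σ d)} {C : Finset (Fin n)} :
    F.IsSmallestLeafCycle (remaining (cyclesOfLength σ d) c k) C ↔
      s.IsSmallestAvoided d k (remaining (cyclesOfLength σ d) c k) C := by
  have hleaf : ∀ D, F.IsLeafCycle (remaining (cyclesOfLength σ d) c k) D ↔
      D ∈ remaining (cyclesOfLength σ d) c k ∧ s.Avoids d k D := by
    intro D
    refine and_congr_right fun hD => ⟨fun h l hkl j hj hjl => ?_, fun h E hE i hi j hj hij => ?_⟩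
    · obtain ⟨m, hm, hml⟩ := hpar l
      exact h (c l) ((mem_remaining_iff_exists rfl hc).2 ⟨l, hkl, rfl⟩) m (Finset.mem_of_min hm)
        j hj (hjl ▸ hml)
    · obtain ⟨l, hkl, rfl⟩ := (mem_remaining_iff_exists rfl hc).1 hE
      obtain ⟨m, hm, hml⟩ := hpar l
      have hcl := (mem_remaining.1 (hc l)).1
      obtain ⟨t, ht⟩ := exists_zpow_apply_eq hcl hi (Finset.mem_of_min hm)
      refine h l hkl ((σ ^ t) j) ((zpow_apply_mem_iff (mem_remaining.1 hD).1 t).2 hj) ?_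
      rw [← F.isParent_iff.1 hml, ← ht, hF.parent_zpow_apply, F.isParent_iff.1 hij,
        Option.map_some]
  simp only [IsSmallestLeafCycle, ExtPruferSeq.IsSmallestAvoided, hleaf, and_imp]

/-- A code determines the order of removal, hence the parents of the minima of all cycles, hence
all parents. -/
lemma eq_of_isCode {G : RootedForest n} (hF : F.IsInvariant σ) (hG : G.IsInvariant σ)
    {s : ExtPruferSeq σ} (h : F.IsCode s) (h' : G.IsCode s) : F = G := by
  refine eq_of_parent_eq (funext fun i => ?_)
  obtain ⟨c, hc⟩ := h (Function.minimalPeriod σ i)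
  obtain ⟨c', hc'⟩ := h' (Function.minimalPeriod σ i)
  have hrem : ∀ k, c k ∈ remaining (cyclesOfLength σ _) c k := fun k => (hc k).1.mem
  have hrem' : ∀ k, c' k ∈ remaining (cyclesOfLength σ _) c' k := fun k => (hc' k).1.mem
  obtain rfl : c = c' := greedy_unique (T := cyclesOfLength σ _)
    (s.IsSmallestAvoided (Function.minimalPeriod σ i))
    (fun _ _ hS _ _ hC hD => hC.unique hS hD)
    (fun k => (isSmallestLeafCycle_iff hF hrem fun k => (hc k).2).1 (hc k).1)
    (fun k => (isSmallestLeafCycle_iff hG hrem' fun k => (hc' k).2).1 (hc' k).1)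
  obtain ⟨k, hk⟩ := exists_eq_of_mem_remaining rfl hrem (cycleSet_mem_cyclesOfLength i)
  obtain ⟨-, m, hm, hpar⟩ := hc k
  obtain ⟨-, m', hm', hpar'⟩ := hc' k
  obtain rfl : m = m' := WithTop.coe_injective (hm.symm.trans hm')
  obtain ⟨t, rfl⟩ := exists_zpow_apply_eq (mem_remaining.1 (hrem k)).1 (Finset.mem_of_min hm)
    (hk ▸ self_mem_cycleSet i)
  rw [hF.parent_zpow_apply, hG.parent_zpow_apply, F.isParent_iff.1 hpar, G.isParent_iff.1 hpar']

end RootedForest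

/-! ### The forest of a sequence -/

/-- The entries of `s` can be prescribed as values at one point `m d k` of each cycle of `σ` (the
`k`-th of the `d`-cycles), and then moved along the cycles by `σ`. This is consistent because
`σ ^ d` fixes the entries of the block of `d`-cycles. -/
lemma exists_equivariant (s : ExtPruferSeq σ) (m : (d : ℕ) → Fin (cycleCount σ d) → Fin n)
    (hper : ∀ d k, Function.minimalPeriod σ (m d k) = d)
    (hinj : ∀ d k l, σ.SameCycle (m d k) (m d l) → k = l)
    (hsurj : ∀ i, ∃ k, σ.SameCycle (m (Function.minimalPeriod σ i) k) i) :
    ∃ p : Fin n → Option (Fin n), ∀ d k (t : ℤ),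
      p ((σ ^ t) (m d k)) = (s.entry d k).map (σ ^ t) := by
  choose κ τ hτ using hsurj
  refine ⟨fun i => (s.entry _ (κ i)).map (σ ^ τ i), fun d k t => ?_⟩
  set i := (σ ^ t) (m d k) with hi
  have hd : d = Function.minimalPeriod σ i := by
    have h : i ∈ cycleSet σ (m d k) := mem_cycleSet.2 ⟨t, rfl⟩
    rw [← card_cycleSet, cycleSet_eq_of_mem h, card_cycleSet, hper]
  clear_value i
  subst hd
  obtain rfl : κ i = k := hinj _ _ _ <|
    Equiv.Perm.SameCycle.trans ⟨τ i, hτ i⟩ (Equiv.Perm.SameCycle.symm ⟨t, hi.symm⟩)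
  exact map_zpow_eq_of_zpow_apply_eq (s.entry_mem _ _) (hper _ _) ((hτ i).trans hi)

/-- Every sequence is a code. The order of removal is found from the sequence by taking the
smallest avoided cycle in each step; the `k`-th entry is then made the parent of the minimum of
the `k`-th cycle. -/
lemma exists_forest_of_code (s : ExtPruferSeq σ) :
    ∃ F : RootedForest n, F.IsInvariant σ ∧ F.IsCode s := by
  have hgreedy := fun d => exists_greedy (T := cyclesOfLength σ d) (N := cycleCount σ d) rfl
    (s.IsSmallestAvoided d) fun k S hS hcard => ExtPruferSeq.exists_isSmallestAvoided hS hcard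
  choose c hrem hc using hgreedy
  have hmem : ∀ d k, c d k ∈ cyclesOfLength σ d := fun d k => (mem_remaining.1 (hrem d k)).1
  choose m hm using fun d k => exists_min_eq (hmem d k)
  have hmc : ∀ d k, m d k ∈ c d k := fun d k => Finset.mem_of_min (hm d k)
  have hcm : ∀ d k, c d k = cycleSet σ (m d k) := fun d k => eq_cycleSet_of_mem (hmem d k) (hmc d k)
  have hper : ∀ d k, Function.minimalPeriod σ (m d k) = d := fun d k =>
    minimalPeriod_eq_of_mem (hmem d k) (hmc d k)
  have hinj : ∀ d k l, σ.SameCycle (m d k) (m d l) → k = l := fun d k l h =>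
    injective_of_mem_remaining (hrem d) <| by
      rw [hcm d k, hcm d l, cycleSet_eq_of_mem (mem_cycleSet.2 h)]
  have hsurj : ∀ i, ∃ k, σ.SameCycle (m (Function.minimalPeriod σ i) k) i := by
    intro i
    obtain ⟨k, hk⟩ := exists_eq_of_mem_remaining (N := cycleCount σ _) rfl (hrem _)
      (cycleSet_mem_cyclesOfLength i)
    refine ⟨k, mem_cycleSet.1 ?_⟩
    rw [← hcm, hk]
    exact self_mem_cycleSet i
  obtain ⟨p, hp⟩ := exists_equivariant s m hper hinj hsurj
  choose κ τ hτ using hsurj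
  have hκ : ∀ d (k : Fin (cycleCount σ d)) x, x ∈ c d k → (κ x : ℕ) = k := by
    intro d k x hx
    obtain rfl := minimalPeriod_eq_of_mem (hmem d k) hx
    rw [hcm, mem_cycleSet] at hx
    exact congrArg Fin.val (hinj _ _ _ (Equiv.Perm.SameCycle.trans ⟨τ x, hτ x⟩ hx.symm))
  -- The height orders the cycles by length and, within one length, by the order of removal:
  -- parents belong to shorter cycles, or to cycles of the same length which are removed later
  have hheight : ∀ i j, p i = some j →
      Function.minimalPeriod σ j * (n + 1) + (n - κ j) <
        Function.minimalPeriod σ i * (n + 1) + (n - κ i) := by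
    intro i j hij
    rw [← hτ i, hp] at hij
    obtain ⟨x, hx, rfl⟩ := Option.map_eq_some_iff.1 hij
    have hxj : x ∈ cycleSet σ ((σ ^ τ i) x) := mem_cycleSet.2 ⟨-τ i, by simp⟩
    have hdvd : Function.minimalPeriod σ ((σ ^ τ i) x) ∣ Function.minimalPeriod σ i := by
      have h := s.entry_mem _ (κ i)
      rw [hx, mem_Lam_iff, Option.map_some, Option.some.injEq, pow_apply_eq_self_iff] at h
      rwa [← card_cycleSet, ← cycleSet_eq_of_mem hxj, card_cycleSet]
    generalize (σ ^ τ i) x = j at *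
    have hpos : 0 < Function.minimalPeriod σ i := by
      rw [← card_cycleSet]
      exact Finset.card_pos.2 ⟨i, self_mem_cycleSet i⟩
    rcases (Nat.le_of_dvd hpos hdvd).lt_or_eq with hlt | heq
    · have := Nat.mul_le_mul_right (n + 1) (Nat.succ_le_of_lt hlt)
      rw [Nat.succ_mul] at this
      omega
    · obtain ⟨l, hl⟩ := exists_eq_of_mem_remaining (N := cycleCount σ _) rfl (hrem _)
        (heq ▸ cycleSet_mem_cyclesOfLength j)
      have hlt : κ i < l := by
        by_contra hle
        exact (hc _ l).1.2 (κ i) (not_lt.1 hle) x (hl ▸ hxj) hx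
      have hj := hκ _ l j (hl ▸ self_mem_cycleSet j)
      have hln := l.2.trans_le (cycleCount_le _)
      rw [hj, heq]
      have := Fin.lt_def.1 hlt
      omega
  obtain ⟨F, rfl⟩ := exists_forest_of_parent hheight
  have hF : F.IsInvariant σ := by
    refine RootedForest.isInvariant_of_parent fun i => ?_
    rw [← hτ i, ← Equiv.Perm.mul_apply, ← zpow_one_add, hp, hp, Option.map_map,
      ← Equiv.Perm.coe_mul, ← zpow_one_add]
  have hpar : ∀ d k, ∃ x : Fin n, (c d k).min = x ∧ F.IsParent x (s.entry d k) := by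
    refine fun d k => ⟨m d k, hm d k, F.isParent_iff.2 ?_⟩
    simpa using hp d k 0
  exact ⟨F, hF, fun d => ⟨c d, fun k => ⟨(RootedForest.isSmallestLeafCycle_iff hF (hrem d)
    (hpar d)).2 (hc d k), hpar d k⟩⟩⟩

end Sequence

end SigmaPrufer

theorem mainTheorem5 (n : ℕ) (σ : Equiv.Perm (Fin n)) :
    ∃ e : {F : SigmaPrufer.RootedForest n // F.IsInvariant σ} ≃ SigmaPrufer.ExtPruferSeq σ,
      ∀ F : {F : SigmaPrufer.RootedForest n // F.IsInvariant σ}, F.1.IsCode (e F) := by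
  choose code hcode using fun F : {F : SigmaPrufer.RootedForest n // F.IsInvariant σ} =>
    SigmaPrufer.RootedForest.exists_isCode F.2
  refine ⟨Equiv.ofBijective code ⟨fun F G h => ?_, fun s => ?_⟩, hcode⟩
  · exact Subtype.ext (SigmaPrufer.RootedForest.eq_of_isCode F.2 G.2 (hcode F) (h ▸ hcode G))
  · obtain ⟨F, hF, hs⟩ := SigmaPrufer.exists_forest_of_code s
    exact ⟨⟨F, hF⟩, (hcode ⟨F, hF⟩).unique hs⟩
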